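/- Let $G=(V,E)$ be a finite connected simple graph and let $G'=(V,E')$ be a simple graph with $E\subseteq E'$; put $F_{GG'}=E'\setminus E$. Let $X_{GG'}$ be the set of all $x\in\{0,1\}^{E'}$ such that (i) $x_e\le\sum_{e'\in C\setminus\{e\}}x_{e'}$ for every cycle $C$ of $G$ and every $e\in C$; (ii) $x_{vw}\le\sum_{e\in P}x_e$ for every $vw\in F_{GG'}$ and every $vw$-path $P$ in $G$; (iii) $1-x_{vw}\le\sum_{e\in C}(1-x_e)$ for every $vw\in F_{GG'}$ and every $vw$-cut $C$ of $G$, i.e. every inclusion-minimal $C\subseteq E$ such that $v$ and $w$ are not connected in $(V,E\setminus C)$. (Cycles and paths are identified with their edge sets.) Let $\Xi_{GG'}=\operatorname{conv}X_{GG'}\subseteq\mathbb{R}^{E'}$ be the lifted multicut polytope. A facet of a polytope is a nonempty face whose dimension is one less than that of the polytope. A cycle in $G'$ is chordless in $G'$ if every edge of $G'$ joining two nodes of the cycle belongs to the cycle. Then: (a) For every cycle $C$ of $G$ and every $e\in C$, the polytope $$\Sigma_{GG'}(e,C)=\operatorname{conv}\Big\{x\in X_{GG'}\;\Big|\;x_e=\sum_{e'\in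 C\setminus\{e\}}x_{e'}\Big\}$$ is a facet of $\Xi_{GG'}$ if and only if $C$ is chordless in $G'$. (b) For every edge $f=vw\in F_{GG'}$ and every $vw$-path $P$ in $G$, the polytope $$\Sigma_{GG'}(f,P)=\operatorname{conv}\Big\{x\in X_{GG'}\;\Big|\;x_f=\sum_{e\in P}x_e\Big\}$$ is a facet of $\Xi_{GG'}$ if and only if the cycle $P\cup\{f\}$ of $G'$ is chordless in $G'$. -/

import Mathlib

noncomputable section

namespace LiftedMulticut

variable {V : Type*} [Fintype V]

open Classical in
/-- The sum `∑_{e ∈ C} x_e` for a vector `x ∈ ℝ^{E'}`, `E'` being the edge set of `G'`, and a set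
`C` of edges of `G'`. -/
def edgeSum {G' : SimpleGraph V} (x : G'.edgeSet → ℝ) (C : Set (Sym2 V)) : ℝ :=
  ∑ e ∈ Finset.univ.filter (fun e : G'.edgeSet => (e : Sym2 V) ∈ C), x e

/-- A `vw`-cut of `G`: an inclusion-minimal set `C` of edges of `G` such that `v` and `w` are
not connected in `(V, E \ C)`. -/
def IsCut (G : SimpleGraph V) (v w : V) (C : Set (Sym2 V)) : Prop :=
  Minimal (fun D : Set (Sym2 V) => D ⊆ G.edgeSet ∧ ¬ (G.deleteEdges D).Reachable v w) C

/-- The set `X_{GG'}` of all `x ∈ {0,1}^{E'}` that satisfy the cycle inequalities for the cycles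
of `G`, and the path and cut inequalities for the edges in `F_{GG'} = E' \ E`. -/
def X (G G' : SimpleGraph V) : Set (G'.edgeSet → ℝ) :=
  {x | (∀ e, x e = 0 ∨ x e = 1) ∧
    (∀ (u : V) (c : G.Walk u u), c.IsCycle → ∀ e : G'.edgeSet, (e : Sym2 V) ∈ c.edges →
      x e ≤ edgeSum x (c.edgeSet \ {(e : Sym2 V)})) ∧
    (∀ (v w : V) (hf : G'.Adj v w), ¬ G.Adj v w → ∀ p : G.Walk v w, p.IsPath →
      x ⟨s(v, w), hf⟩ ≤ edgeSum x p.edgeSet) ∧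
    (∀ (v w : V) (hf : G'.Adj v w), ¬ G.Adj v w → ∀ C : Set (Sym2 V), IsCut G v w C →
      1 - x ⟨s(v, w), hf⟩ ≤ edgeSum (fun e => 1 - x e) C)}

/-- The lifted multicut polytope `Ξ_{GG'}`. -/
def Xi (G G' : SimpleGraph V) : Set (G'.edgeSet → ℝ) :=
  convexHull ℝ (X G G')

/-- `Σ_{GG'}(e, C)`: the convex hull of the points of `X_{GG'}` at which
`x_e = ∑_{e' ∈ C \ {e}} x_{e'}`. -/
def SigmaCycle (G G' : SimpleGraph V) (e : G'.edgeSet) (C : Set (Sym2 V)) :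
    Set (G'.edgeSet → ℝ) :=
  convexHull ℝ {x ∈ X G G' | x e = edgeSum x (C \ {(e : Sym2 V)})}

/-- `Σ_{GG'}(f, P)`: the convex hull of the points of `X_{GG'}` at which
`x_f = ∑_{e ∈ P} x_e`. -/
def SigmaPath (G G' : SimpleGraph V) (f : G'.edgeSet) (P : Set (Sym2 V)) :
    Set (G'.edgeSet → ℝ) :=
  convexHull ℝ {x ∈ X G G' | x f = edgeSum x P}

/-- `F` is a facet of `Q`: a nonempty face (the points of `Q` maximizing some linear functional)
whose affine dimension is one less than that of `Q`. -/
def IsFacet {ι : Type*} (Q F : Set (ι → ℝ)) : Prop :=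
  F.Nonempty ∧ IsExposed ℝ Q F ∧
    Module.finrank ℝ (vectorSpan ℝ F) + 1 = Module.finrank ℝ (vectorSpan ℝ Q)

end LiftedMulticut

end

/-!
A cycle `C` of `G` with an edge `e`, and a path `P` of `G` with an edge `f` outside `G`, are the
same situation: an edge `f = vw` of `G'` and a `vw`-path `P` of `G` that avoids `f`. In this setting
the inequality `x_f ≤ ∑_{e ∈ P} x_e` is shown to define a facet exactly if every edge of `G'`
between nodes of `P` belongs to `P ∪ {f}` (`isFacet_sigmaPath_iff`).

The polytope contains the origin and is full-dimensional (`span_X`), so the face is a facet if and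
only if every linear functional vanishing on it is a multiple of `x_f - ∑_{e ∈ P} x_e`
(`isFacet_iff_forall_dual`).

A point of `X_{GG'}` vanishes at an edge exactly if its ends are joined by edges of `G` with value
zero (`eq_zero_iff_reachable`), so it satisfies the inequality of every walk of `G'`. If `ab` is a
chord and `Q` is the part of `P` between `a` and `b`, then both `x_{ab} ≤ ∑_Q x_e` and
`x_f ≤ x_{ab} + ∑_{P \ Q} x_e` hold, so that `x_{ab} = ∑_Q x_e` on the face, which is therefore
too small (`eq_edgeSum_of_chord`).

Conversely, let a functional vanish on the face, and regard its coefficients as weights on pairs of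
nodes. The face contains the multicuts of decompositions into singletons and two connected blocks,
where either one block contains `P`, or the blocks contain the two parts of `P` minus an edge. For
these, the total weight inside the blocks is constant (`Balanced`). Comparing such decompositions
shows that there is no weight on pairs of one node off `P` and one on `P`
(`Balanced.eq_zero_of_mem_right`), nor on pairs off `P` (`Balanced.eq_zero_of_notMem`). Without
chords, the weight between the two parts of `P` minus an edge `e` is that of `e` plus that of `f`,
and it is zero as well (`Balanced.add_eq_zero`). Hence the functional is a multiple of
`x_f - ∑_{e ∈ P} x_e`.
-/

namespace LiftedMulticut

/-! ### Connected node sets -/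

/-- A set `B` of nodes is connected in `G` if any two of its nodes are joined by a walk of `G` that
stays in `B`. The empty set is connected in this sense. -/
def ConnOn {V : Type*} (G : SimpleGraph V) (B : Finset V) : Prop :=
  ∀ a ∈ B, ∀ b ∈ B, ∃ p : G.Walk a b, ∀ c ∈ p.support, c ∈ B

section ConnOn

variable {V : Type*} {G : SimpleGraph V}

lemma ConnOn.empty : ConnOn G ∅ := by
  intro a ha
  simp at ha

lemma ConnOn.singleton (u : V) : ConnOn G {u} := by
  intro a ha b hb
  rw [Finset.mem_singleton] at ha hb
  subst ha hb
  exact ⟨.nil, by simp⟩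

lemma ConnOn.union [DecidableEq V] {A B : Finset V} (hA : ConnOn G A) (hB : ConnOn G B) {a b : V}
    (ha : a ∈ A) (hb : b ∈ B) (hab : G.Adj a b) : ConnOn G (A ∪ B) := by
  have key : ∀ x ∈ A, ∀ y ∈ B, ∃ p : G.Walk x y, ∀ c ∈ p.support, c ∈ A ∪ B := by
    intro x hx y hy
    obtain ⟨p, hp⟩ := hA x hx a ha
    obtain ⟨q, hq⟩ := hB b hb y hy
    refine ⟨p.append (.cons hab q), fun c hc => ?_⟩
    rw [SimpleGraph.Walk.mem_support_append_iff, SimpleGraph.Walk.support_cons,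
      List.mem_cons] at hc
    rw [Finset.mem_union]
    rcases hc with h | rfl | h
    exacts [.inl (hp c h), .inl ha, .inr (hq c h)]
  intro x hx y hy
  rcases Finset.mem_union.1 hx with hx | hx <;> rcases Finset.mem_union.1 hy with hy | hy
  · obtain ⟨p, hp⟩ := hA x hx y hy
    exact ⟨p, fun c hc => Finset.mem_union_left _ (hp c hc)⟩
  · exact key x hx y hy
  · obtain ⟨p, hp⟩ := key y hy x hx
    exact ⟨p.reverse, fun c hc => hp c (by simpa using hc)⟩
  · obtain ⟨p, hp⟩ := hB x hx y hy
    exact ⟨p, fun c hc => Finset.mem_union_right _ (hp c hc)⟩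

lemma ConnOn.insert [DecidableEq V] {B : Finset V} (hB : ConnOn G B) {u b : V} (hb : b ∈ B)
    (hub : G.Adj u b) : ConnOn G (insert u B) := by
  rw [Finset.insert_eq]
  exact (ConnOn.singleton u).union hB (Finset.mem_singleton_self u) hb hub

lemma ConnOn.support [DecidableEq V] {x y : V} (p : G.Walk x y) :
    ConnOn G p.support.toFinset := by
  induction p with
  | nil => simpa using ConnOn.singleton _
  | cons h p ih =>
    rw [SimpleGraph.Walk.support_cons, List.toFinset_cons]
    exact ih.insert (by simp) h

/-- The nodes with positions `m, …, n` on a walk form a connected set. -/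
lemma ConnOn.image_getVert [DecidableEq V] {x y : V} (p : G.Walk x y) (m n : ℕ)
    (hn : n ≤ p.length) : ConnOn G ((Finset.Icc m n).image p.getVert) := by
  induction n with
  | zero =>
    rcases Nat.eq_zero_or_pos m with rfl | hm
    · simpa using ConnOn.singleton _
    · rw [Finset.Icc_eq_empty (by omega)]
      simpa using ConnOn.empty
  | succ n ih =>
    rcases lt_trichotomy m (n + 1) with hm | rfl | hm
    · rw [← Finset.insert_Icc_right_eq_Icc_add_one (by omega), Finset.image_insert]
      exact (ih (by omega)).insert
        (Finset.mem_image_of_mem _ (Finset.mem_Icc.2 ⟨by omega, le_rfl⟩))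
        (p.adj_getVert_succ (by omega)).symm
    · simpa using ConnOn.singleton _
    · rw [Finset.Icc_eq_empty (by omega)]
      simpa using ConnOn.empty

/-- Induction towards a node set `Q`: a property holds at every node off `Q` from which `Q` can be
reached, provided it passes to the node `u` of any connected set `R` off `Q` with a neighbour
in `Q` as soon as it holds at the other nodes of `R`. -/
lemma grow_induction [DecidableEq V] (hG : G.Connected) {Q : Finset V} (hQ : Q.Nonempty)
    (good : V → Prop)
    (h : ∀ (R : Finset V) (u r q : V), ConnOn G R → Disjoint R Q → u ∈ R → r ∈ R → q ∈ Q →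
      G.Adj r q → (∀ y ∈ R, y ≠ u → good y) → good u) :
    ∀ u, u ∉ Q → good u := by
  obtain ⟨z, hz⟩ := hQ
  have key : ∀ {u z : V} (_ : G.Walk u z), z ∈ Q → u ∉ Q → ∃ R : Finset V, ConnOn G R ∧
      Disjoint R Q ∧ u ∈ R ∧ (∃ r ∈ R, ∃ q ∈ Q, G.Adj r q) ∧ ∀ y ∈ R, good y := by
    intro u z p
    induction p with
    | nil => exact fun h1 h2 => absurd h1 h2
    | @cons u x z hux p ih =>
      intro hz hu
      by_cases hx : x ∈ Q
      · have hd : Disjoint {u} Q := Finset.disjoint_singleton_left.2 hu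
        have hu' := Finset.mem_singleton_self u
        refine ⟨{u}, .singleton u, hd, hu', ⟨u, hu', x, hx, hux⟩, fun y hy => ?_⟩
        rw [Finset.mem_singleton.1 hy]
        refine h {u} u u x (.singleton u) hd hu' hu' hx hux fun y hy hyu => ?_
        exact absurd (Finset.mem_singleton.1 hy) hyu
      · obtain ⟨R, hR, hd, hxR, ⟨r, hr, q, hq, hrq⟩, hgood⟩ := ih hz hx
        have hd' : Disjoint (insert u R) Q := Finset.disjoint_insert_left.2 ⟨hu, hd⟩
        have hc := hR.insert hxR hux
        have hu' := Finset.mem_insert_self u R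
        refine ⟨insert u R, hc, hd', hu', ⟨r, Finset.mem_insert_of_mem hr, q, hq, hrq⟩,
          fun y hy => ?_⟩
        rcases Finset.mem_insert.1 hy with rfl | hy
        · refine h _ y r q hc hd' hu' (Finset.mem_insert_of_mem hr) hq hrq fun t ht hty => ?_
          exact hgood t ((Finset.mem_insert.1 ht).resolve_left hty)
        · exact hgood y hy
  intro u hu
  obtain ⟨p⟩ := hG.preconnected u z
  obtain ⟨R, -, -, huR, -, hgood⟩ := key p hz hu
  exact hgood u huR

end ConnOn

/-! ### Weights on pairs of nodes -/

/-- The total weight of the ordered pairs in `A × B`. -/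
def cross {V : Type*} (β : V → V → ℝ) (A B : Finset V) : ℝ :=
  ∑ x ∈ A, ∑ y ∈ B, β x y

section Weights

variable {V : Type*} {β : V → V → ℝ}

lemma cross_comm (hs : ∀ x y, β x y = β y x) (A B : Finset V) : cross β A B = cross β B A := by
  unfold cross
  rw [Finset.sum_comm]
  simp only [hs]

lemma cross_union_left [DecidableEq V] {A B : Finset V} (h : Disjoint A B) (C : Finset V) :
    cross β (A ∪ B) C = cross β A C + cross β B C :=
  Finset.sum_union h

lemma cross_union_self [DecidableEq V] (hs : ∀ x y, β x y = β y x) {A B : Finset V}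
    (h : Disjoint A B) :
    cross β (A ∪ B) (A ∪ B) = cross β A A + cross β B B + 2 * cross β A B := by
  rw [cross_union_left h, cross_comm hs A, cross_comm hs B, cross_union_left h,
    cross_union_left h, cross_comm hs B A]
  ring

/-- If only one row of `A × B` carries weight, `cross` is the sum over that row. -/
lemma cross_eq_row {A B : Finset V} {u : V} (hu : u ∈ A)
    (h : ∀ x ∈ A, x ≠ u → ∑ y ∈ B, β x y = 0) : cross β A B = ∑ y ∈ B, β u y :=
  Finset.sum_eq_single_of_mem u hu h

/-- If every connected node set off `Q` has total weight zero, then so does every pair of nodes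
joined by a walk off `Q`. The support of the walk has weight zero, and by induction on the length
all of its pairs other than the two ends do not contribute. -/
lemma weight_eq_zero_of_walk [DecidableEq V] {G : SimpleGraph V} {Q : Finset V}
    (hs : ∀ x y, β x y = β y x)
    (hd : ∀ x, β x x = 0)
    (h : ∀ B : Finset V, ConnOn G B → Disjoint B Q → cross β B B = 0) {x y : V}
    (p : G.Walk x y) (hp : ∀ c ∈ p.support, c ∉ Q) : β x y = 0 := by
  suffices H : ∀ n : ℕ, ∀ (x y : V) (p : G.Walk x y), p.length = n →
      (∀ c ∈ p.support, c ∉ Q) → β x y = 0 from H _ x y p rfl hp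
  intro n
  induction n using Nat.strong_induction_on with
  | _ n ih =>
  intro x y p hn hp
  by_cases hxy : x = y
  · rw [hxy, hd]
  have small : ∀ i j : ℕ, i ≤ j → j ≤ n → j - i < n → β (p.getVert i) (p.getVert j) = 0 := by
    intro i j hij hj hlt
    have hq := ih (j - i) hlt _ _ ((p.drop i).take (j - i)) (by simp; omega) (by
      intro c hc
      exact hp c ((p.isSubwalk_drop i).support_subset
        (((p.drop i).isSubwalk_take (j - i)).support_subset hc)))
    rwa [SimpleGraph.Walk.drop_getVert, Nat.add_sub_cancel' hij] at hq
  have pair : ∀ a ∈ p.support, ∀ b ∈ p.support, ¬ (a = x ∧ b = y) → ¬ (a = y ∧ b = x) →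
      β a b = 0 := by
    intro a ha b hb h1 h2
    obtain ⟨i, rfl, hi⟩ := SimpleGraph.Walk.mem_support_iff_exists_getVert.1 ha
    obtain ⟨j, rfl, hj⟩ := SimpleGraph.Walk.mem_support_iff_exists_getVert.1 hb
    have e0 := p.getVert_zero
    have en := p.getVert_length
    rcases le_total i j with hij | hij
    · refine small i j hij (by omega) ?_
      by_contra hlt
      obtain rfl : i = 0 := by omega
      obtain rfl : j = p.length := by omega
      exact h1 ⟨e0, en⟩
    · rw [hs]
      refine small j i hij (by omega) ?_
      by_contra hlt
      obtain rfl : j = 0 := by omega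
      obtain rfl : i = p.length := by omega
      exact h2 ⟨en, e0⟩
  have hg := h _ (ConnOn.support p) (by
    rw [Finset.disjoint_left]
    exact fun c hc => hp c (List.mem_toFinset.1 hc))
  have hx : x ∈ p.support.toFinset := by simp
  have hy : y ∈ p.support.toFinset := by simp
  have hrow : ∀ a ∈ p.support.toFinset, a ≠ x ∧ a ≠ y →
      ∑ b ∈ p.support.toFinset, β a b = 0 := by
    intro a ha hne
    refine Finset.sum_eq_zero fun b hb => ?_
    exact pair a (List.mem_toFinset.1 ha) b (List.mem_toFinset.1 hb)
      (fun hh => hne.1 hh.1) (fun hh => hne.2 hh.1)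
  unfold cross at hg
  rw [Finset.sum_eq_add_of_mem x y hx hy hxy hrow,
    Finset.sum_eq_single_of_mem y hy fun b hb hby =>
      pair x (by simp) b (List.mem_toFinset.1 hb) (fun hh => hby hh.2) (fun hh => hxy hh.1),
    Finset.sum_eq_single_of_mem x hx fun b hb hbx =>
      pair y (by simp) b (List.mem_toFinset.1 hb) (fun hh => hxy hh.1.symm) (fun hh => hbx hh.2),
    hs y x] at hg
  linarith

end Weights

/-! ### Weights balanced along a path -/

section PathWeights

lemma eq_zero_of_prefix_suffix_sums {f : ℕ → ℝ} {j n : ℕ} (hj : j ≤ n)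
    (h1 : ∀ m, j ≤ m → m ≤ n → ∑ t ∈ Finset.Icc 0 m, f t = 0)
    (h2 : ∀ m, m ≤ j → ∑ t ∈ Finset.Icc m n, f t = 0) : ∀ m, m ≤ n → f m = 0 := by
  have lt : ∀ m, m < j → f m = 0 := by
    intro m hm
    have a := h2 m hm.le
    rw [← Finset.insert_Icc_add_one_left_eq_Icc (by omega), Finset.sum_insert (by simp),
      h2 (m + 1) hm] at a
    linarith
  have gt : ∀ m, j < m → m ≤ n → f m = 0 := by
    intro m hm hn
    obtain ⟨k, rfl⟩ : ∃ k, m = k + 1 := ⟨m - 1, by omega⟩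
    have a := h1 (k + 1) hm.le hn
    rw [← Finset.insert_Icc_right_eq_Icc_add_one (by omega), Finset.sum_insert (by simp),
      h1 k (by omega) (by omega)] at a
    linarith
  intro m hm
  rcases lt_trichotomy m j with h | rfl | h
  · exact lt m h
  · have a := h1 m le_rfl hm
    rwa [Finset.sum_eq_single_of_mem m (by simp)] at a
    intro t ht htm
    rw [Finset.mem_Icc] at ht
    exact lt t (by omega)
  · exact gt m h hm

variable {V : Type*} [DecidableEq V] {G : SimpleGraph V} {v w : V} {β : V → V → ℝ}

/-- The nodes of the walk `p` with positions `m, …, n`. -/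
def segment (p : G.Walk v w) (m n : ℕ) : Finset V :=
  (Finset.Icc m n).image p.getVert

lemma mem_segment {p : G.Walk v w} {m n : ℕ} {a : V} :
    a ∈ segment p m n ↔ ∃ i, m ≤ i ∧ i ≤ n ∧ p.getVert i = a := by
  simp [segment, and_assoc]

lemma connOn_segment (p : G.Walk v w) (m : ℕ) {n : ℕ} (hn : n ≤ p.length) :
    ConnOn G (segment p m n) :=
  .image_getVert p m n hn

lemma mem_segment_length {p : G.Walk v w} {a : V} :
    a ∈ segment p 0 p.length ↔ a ∈ p.support := by
  rw [mem_segment, SimpleGraph.Walk.mem_support_iff_exists_getVert]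
  grind

lemma segment_union (p : G.Walk v w) {i : ℕ} (hi : i < p.length) :
    segment p 0 i ∪ segment p (i + 1) p.length = segment p 0 p.length := by
  ext a
  simp only [Finset.mem_union, mem_segment]
  grind

lemma segment_disjoint {p : G.Walk v w} (hp : p.IsPath) (i : ℕ) (hi : i < p.length) :
    Disjoint (segment p 0 i) (segment p (i + 1) p.length) := by
  rw [Finset.disjoint_left]
  intro a ha hb
  obtain ⟨s, -, hs, rfl⟩ := mem_segment.1 ha
  obtain ⟨t, ht, ht', hst⟩ := mem_segment.1 hb
  have := hp.getVert_injOn (show t ≤ p.length from ht') (show s ≤ p.length by omega) hst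
  omega

lemma sum_segment {p : G.Walk v w} (hp : p.IsPath) (f : V → ℝ) (m : ℕ) {n : ℕ}
    (hn : n ≤ p.length) : ∑ y ∈ segment p m n, f y = ∑ t ∈ Finset.Icc m n, f (p.getVert t) := by
  refine Finset.sum_image fun s hs t ht hst => ?_
  have hs := Finset.mem_Icc.1 hs
  have ht := Finset.mem_Icc.1 ht
  exact hp.getVert_injOn (show s ≤ p.length by omega) (show t ≤ p.length by omega) hst

/-- The weight identities that a linear functional vanishing on the face gives rise to. The total
weight inside the blocks of a decomposition equals `T` for every decomposition into singletons and
two connected blocks `B₁` and `B₂`, where either `B₁` contains all of the path `p`, or `B₁` and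
`B₂` contain the two parts into which the removal of one edge divides `p`. -/
structure Balanced (p : G.Walk v w) (β : V → V → ℝ) (T : ℝ) : Prop where
  symm : ∀ x y, β x y = β y x
  diag : ∀ x, β x x = 0
  whole : ∀ B₁ B₂ : Finset V, ConnOn G B₁ → ConnOn G B₂ → Disjoint B₁ B₂ →
    segment p 0 p.length ⊆ B₁ → cross β B₁ B₁ + cross β B₂ B₂ = T
  split : ∀ B₁ B₂ : Finset V, ConnOn G B₁ → ConnOn G B₂ → Disjoint B₁ B₂ →
    ∀ i < p.length, segment p 0 i ⊆ B₁ → segment p (i + 1) p.length ⊆ B₂ →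
      cross β B₁ B₁ + cross β B₂ B₂ = T

namespace Balanced

variable {p : G.Walk v w} {T : ℝ}

lemma cross_segment (h : Balanced p β T) :
    cross β (segment p 0 p.length) (segment p 0 p.length) = T := by
  simpa [cross] using h.whole _ ∅ (connOn_segment p _ le_rfl) .empty (Finset.disjoint_empty_right _)
    subset_rfl

/-- A connected set off the path has weight zero: it may be taken as the second block. -/
lemma cross_self_of_disjoint (h : Balanced p β T) {B : Finset V} (hB : ConnOn G B)
    (hd : Disjoint B (segment p 0 p.length)) : cross β B B = 0 := by
  have := h.whole _ B (connOn_segment p _ le_rfl) hB hd.symm subset_rfl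
  have := h.cross_segment
  linarith

lemma cross_segments (h : Balanced p β T) (hp : p.IsPath) {i : ℕ} (hi : i < p.length) :
    cross β (segment p 0 i) (segment p (i + 1) p.length) = 0 := by
  have h1 := h.split _ _ (connOn_segment p 0 hi.le) (connOn_segment p (i + 1) le_rfl)
    (segment_disjoint hp i hi) i hi subset_rfl subset_rfl
  have h2 := h.cross_segment
  rw [← segment_union p hi, cross_union_self h.symm (segment_disjoint hp i hi)] at h2
  linarith

lemma cross_eq_zero_of_adj (h : Balanced p β T) {R : Finset V} (hR : ConnOn G R)
    (hd : Disjoint R (segment p 0 p.length)) {r : V} (hr : r ∈ R) {j : ℕ} (hj : j ≤ p.length)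
    (hrj : G.Adj r (p.getVert j)) : cross β R (segment p 0 p.length) = 0 := by
  have hc := hR.union (connOn_segment p 0 le_rfl) hr
    (mem_segment.2 ⟨j, Nat.zero_le j, hj, rfl⟩) hrj
  have h1 := h.whole _ ∅ hc .empty (Finset.disjoint_empty_right _) Finset.subset_union_right
  have h2 := h.cross_segment
  have h3 := h.cross_self_of_disjoint hR hd
  rw [cross_union_self h.symm hd] at h1
  simp only [cross, Finset.sum_empty] at h1 h2 h3 ⊢
  linarith

/-- Attaching a connected set `R` off the path to the part of the path that contains a neighbour
of `R` changes no total weight. -/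
lemma cross_prefix (h : Balanced p β T) (hp : p.IsPath) {R : Finset V} (hR : ConnOn G R)
    (hd : Disjoint R (segment p 0 p.length)) {r : V} (hr : r ∈ R) {i j : ℕ} (hji : j ≤ i)
    (hi : i < p.length) (hrj : G.Adj r (p.getVert j)) : cross β R (segment p 0 i) = 0 := by
  rw [← segment_union p hi, Finset.disjoint_union_right] at hd
  have hc := hR.union (connOn_segment p 0 hi.le) hr
    (mem_segment.2 ⟨j, Nat.zero_le j, hji, rfl⟩) hrj
  have hB := connOn_segment p (i + 1) le_rfl
  have hdis := segment_disjoint hp i hi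
  have h1 := h.split _ _ hc hB (Finset.disjoint_union_left.2 ⟨hd.2, hdis⟩) i hi
    Finset.subset_union_right subset_rfl
  have h2 := h.split _ _ (connOn_segment p 0 hi.le) hB hdis i hi subset_rfl subset_rfl
  have h3 := h.cross_self_of_disjoint hR
    (by rw [← segment_union p hi]; exact Finset.disjoint_union_right.2 hd)
  rw [cross_union_self h.symm hd.1] at h1
  linarith

lemma cross_suffix (h : Balanced p β T) (hp : p.IsPath) {R : Finset V} (hR : ConnOn G R)
    (hd : Disjoint R (segment p 0 p.length)) {r : V} (hr : r ∈ R) {i j : ℕ} (hij : i < j)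
    (hj : j ≤ p.length) (hrj : G.Adj r (p.getVert j)) :
    cross β R (segment p (i + 1) p.length) = 0 := by
  have hi : i < p.length := by omega
  rw [← segment_union p hi, Finset.disjoint_union_right] at hd
  have hc := hR.union (connOn_segment p (i + 1) le_rfl) hr
    (mem_segment.2 ⟨j, hij, hj, rfl⟩) hrj
  have hA := connOn_segment p 0 hi.le
  have hdis := segment_disjoint hp i hi
  have h1 := h.split _ _ hA hc (Finset.disjoint_union_right.2 ⟨hd.1.symm, hdis⟩) i hi
    subset_rfl Finset.subset_union_right
  have h2 := h.split _ _ hA (connOn_segment p (i + 1) le_rfl) hdis i hi subset_rfl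
    subset_rfl
  have h3 := h.cross_self_of_disjoint hR
    (by rw [← segment_union p hi]; exact Finset.disjoint_union_right.2 hd)
  rw [cross_union_self h.symm hd.2] at h1
  linarith

/-- Pairs of a node off the path and a node on the path carry no weight. -/
lemma eq_zero_of_mem_right (h : Balanced p β T) (hG : G.Connected) (hp : p.IsPath) :
    ∀ u, u ∉ segment p 0 p.length → ∀ q ∈ segment p 0 p.length, β u q = 0 := by
  refine grow_induction hG ⟨v, mem_segment_length.2 (by simp)⟩
    (fun u => ∀ q ∈ segment p 0 p.length, β u q = 0) ?_
  intro R u r q₀ hR hd hu hr hq₀ hrq hgood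
  obtain ⟨j, -, hj, rfl⟩ := mem_segment.1 hq₀
  have row : ∀ m n, n ≤ p.length → cross β R (segment p m n) = 0 →
      ∑ t ∈ Finset.Icc m n, β u (p.getVert t) = 0 := by
    intro m n hn hc
    rw [← sum_segment hp (β u) m hn, ← cross_eq_row hu, hc]
    intro x hx hxu
    refine Finset.sum_eq_zero fun y hy => hgood x hx hxu y ?_
    obtain ⟨i, -, hi, rfl⟩ := mem_segment.1 hy
    exact mem_segment.2 ⟨i, Nat.zero_le i, hi.trans hn, rfl⟩
  have key := eq_zero_of_prefix_suffix_sums (f := fun t => β u (p.getVert t)) hj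
    (fun m hjm hm => row 0 m hm (by
      rcases hm.eq_or_lt with rfl | hm
      · exact h.cross_eq_zero_of_adj hR hd hr hj hrq
      · exact h.cross_prefix hp hR hd hr hjm hm hrq))
    (fun m hm => row m _ le_rfl (by
      rcases m with _ | m
      · exact h.cross_eq_zero_of_adj hR hd hr hj hrq
      · exact h.cross_suffix hp hR hd hr hm hj hrq))
  intro q hq
  obtain ⟨i, -, hi, rfl⟩ := mem_segment.1 hq
  exact key i hi

/-- Two disjoint connected sets off the path, each with a neighbour on the path, carry no weight
between them: together with the path they form a single block. -/
lemma cross_of_attached (h : Balanced p β T) (hG : G.Connected) (hp : p.IsPath)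
    {R S : Finset V} (hR : ConnOn G R) (hS : ConnOn G S) (hRS : Disjoint R S)
    (hdR : Disjoint R (segment p 0 p.length)) (hdS : Disjoint S (segment p 0 p.length))
    {r q s t : V} (hr : r ∈ R) (hq : q ∈ segment p 0 p.length) (hrq : G.Adj r q)
    (hs : s ∈ S) (ht : t ∈ segment p 0 p.length) (hst : G.Adj s t) : cross β R S = 0 := by
  have zero : ∀ A : Finset V, Disjoint A (segment p 0 p.length) →
      cross β A (segment p 0 p.length) = 0 := fun A hA =>
    Finset.sum_eq_zero fun x hx => Finset.sum_eq_zero fun y hy =>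
      h.eq_zero_of_mem_right hG hp x (Finset.disjoint_left.1 hA hx) y hy
  have hQ : ConnOn G (segment p 0 p.length) := connOn_segment p _ le_rfl
  have hc := hR.union (hS.union hQ hs ht hst) hr (Finset.mem_union_right _ hq) hrq
  have h1 := h.whole _ ∅ hc .empty (Finset.disjoint_empty_right _)
    (Finset.subset_union_right.trans Finset.subset_union_right)
  rw [cross_union_self h.symm (Finset.disjoint_union_right.2 ⟨hRS, hdR⟩),
    cross_union_self h.symm hdS, cross_comm h.symm R (S ∪ _), cross_union_left hdS,
    cross_comm h.symm S R, cross_comm h.symm (segment _ _ _) R, zero R hdR, zero S hdS,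
    h.cross_segment,
    h.cross_self_of_disjoint hR hdR, h.cross_self_of_disjoint hS hdS] at h1
  simp only [cross, Finset.sum_empty] at h1 ⊢
  linarith

/-- Pairs of nodes off the path carry no weight. Pairs joined by a walk off the path are covered
by `weight_eq_zero_of_walk`; the others lie in disjoint connected sets that can be grown
towards the path independently of each other. -/
lemma eq_zero_of_notMem (h : Balanced p β T) (hG : G.Connected) (hp : p.IsPath) {x y : V}
    (hx : x ∉ segment p 0 p.length) (hy : y ∉ segment p 0 p.length) : β x y = 0 := by
  set Q := segment p 0 p.length with hQ
  have hne : Q.Nonempty := ⟨v, mem_segment_length.2 (by simp)⟩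
  -- `J a b` means that `a` and `b` are joined by a walk off the path.
  let J : V → V → Prop := fun a b => ∃ q : G.Walk a b, ∀ c ∈ q.support, c ∉ Q
  have J_trans : ∀ {a b c}, J a b → J b c → J a c := by
    rintro a b c ⟨q, hq⟩ ⟨q', hq'⟩
    refine ⟨q.append q', fun d hd => ?_⟩
    rcases (SimpleGraph.Walk.mem_support_append_iff _ _).1 hd with hd | hd
    exacts [hq d hd, hq' d hd]
  have J_symm : ∀ {a b}, J a b → J b a := by
    rintro a b ⟨q, hq⟩
    exact ⟨q.reverse, fun c hc => hq c (by simpa using hc)⟩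
  have J_conn : ∀ {R : Finset V}, ConnOn G R → Disjoint R Q → ∀ a ∈ R, ∀ b ∈ R, J a b := by
    intro R hR hd a ha b hb
    obtain ⟨q, hq⟩ := hR a ha b hb
    exact ⟨q, fun c hc => Finset.disjoint_left.1 hd (hq c hc)⟩
  by_cases hxy : J x y
  · obtain ⟨q, hq⟩ := hxy
    exact weight_eq_zero_of_walk h.symm h.diag (fun B hB hd => h.cross_self_of_disjoint hB hd) q hq
  -- First the set around `x` is grown for a fixed attached set `S`, and then `S` itself.
  have step : ∀ (S : Finset V) (s t : V), ConnOn G S → Disjoint S Q → s ∈ S → t ∈ Q →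
      G.Adj s t → ∀ u, u ∉ Q → (∀ z ∈ S, ¬ J u z) → ∑ z ∈ S, β u z = 0 := by
    intro S s t hS hdS hs ht hst
    refine grow_induction hG hne (fun u => (∀ z ∈ S, ¬ J u z) → ∑ z ∈ S, β u z = 0) ?_
    intro R u r q hR hd hu hr hq hrq hgood hun
    have hRS : ∀ a ∈ R, ∀ z ∈ S, ¬ J a z := fun a ha z hz haz =>
      hun z hz (J_trans (J_conn hR hd u hu a ha) haz)
    have hdis : Disjoint R S := by
      rw [Finset.disjoint_left]
      exact fun a ha haS => hRS a ha a haS (J_conn hR hd a ha a ha)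
    rw [← cross_eq_row hu fun a ha hau => hgood a ha hau (hRS a ha)]
    exact h.cross_of_attached hG hp hR hS hdis hd hdS hr hq hrq hs ht hst
  have main := grow_induction hG hne
    (fun u' => ∀ u, u ∉ Q → ¬ J u u' → β u u' = 0) (by
      intro S u' s t hS hdS hu' hs ht hst hgood u hu hun
      have hnJ : ∀ z ∈ S, ¬ J u z := fun z hz huz =>
        hun (J_trans huz (J_conn hS hdS z hz u' hu'))
      have hsum := step S s t hS hdS hs ht hst u hu hnJ
      rwa [Finset.sum_eq_single_of_mem u' hu' fun z hz hzu => hgood z hz hzu u hu (hnJ z hz)]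
        at hsum)
  exact main y hy x hx hxy

/-- If the only weight between nodes of the path sits on the edges of the path and on the pair of
its ends, then the weight of each edge of the path is opposite to that of the pair of ends. -/
lemma add_eq_zero (h : Balanced p β T) (hp : p.IsPath) (hlen : 2 ≤ p.length)
    (hch : ∀ s t, s < t → t ≤ p.length → t ≠ s + 1 → ¬ (s = 0 ∧ t = p.length) →
      β (p.getVert s) (p.getVert t) = 0) {i : ℕ} (hi : i < p.length) :
    β (p.getVert i) (p.getVert (i + 1)) + β v w = 0 := by
  have hc := h.cross_segments hp hi
  unfold cross at hc
  rw [sum_segment hp _ 0 hi.le] at hc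
  simp only [sum_segment hp _ (i + 1) le_rfl] at hc
  rw [← Finset.sum_product', Finset.sum_eq_add_of_mem (i, i + 1) (0, p.length) (by simp; omega)
    (by simp; omega) (by simp; omega)] at hc
  · simpa using hc
  · rintro ⟨s, t⟩ hst hne
    simp only [Finset.mem_product, Finset.mem_Icc] at hst
    simp only [ne_eq, Prod.mk.injEq] at hne
    exact hch s t (by omega) hst.2.2 (by omega) hne.2

end Balanced

end PathWeights

/-! ### Sums over sets of edges -/

section EdgeSum

variable {V : Type*} [Fintype V] {G' : SimpleGraph V} {x : G'.edgeSet → ℝ}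

lemma le_edgeSum (hx : ∀ e, 0 ≤ x e) {C : Set (Sym2 V)} {e : G'.edgeSet}
    (he : (e : Sym2 V) ∈ C) : x e ≤ edgeSum x C :=
  Finset.single_le_sum (fun e _ => hx e) (by simpa using he)

lemma edgeSum_nonneg (hx : ∀ e, 0 ≤ x e) (C : Set (Sym2 V)) : 0 ≤ edgeSum x C :=
  Finset.sum_nonneg fun e _ => hx e

lemma edgeSum_eq_zero {C : Set (Sym2 V)} (h : ∀ e : G'.edgeSet, (e : Sym2 V) ∈ C → x e = 0) :
    edgeSum x C = 0 :=
  Finset.sum_eq_zero fun e he => h e (by simpa using he)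

lemma edgeSum_eq_single {C : Set (Sym2 V)} {e : G'.edgeSet} (he : (e : Sym2 V) ∈ C)
    (h : ∀ e' : G'.edgeSet, (e' : Sym2 V) ∈ C → e' ≠ e → x e' = 0) : edgeSum x C = x e :=
  Finset.sum_eq_single_of_mem e (by simpa using he) fun e' he' => h e' (by simpa using he')

lemma edgeSum_union {C D : Set (Sym2 V)} (h : Disjoint C D) :
    edgeSum x (C ∪ D) = edgeSum x C + edgeSum x D := by
  classical
  unfold edgeSum
  rw [← Finset.sum_union]
  · congr 1
    ext e
    simp
  · rw [Finset.disjoint_left]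
    intro e hC hD
    exact Set.disjoint_left.1 h (by simpa using hC) (by simpa using hD)

lemma edgeSum_union_le (hx : ∀ e, 0 ≤ x e) (C D : Set (Sym2 V)) :
    edgeSum x (C ∪ D) ≤ edgeSum x C + edgeSum x D := by
  rw [← Set.union_sdiff_self, edgeSum_union Set.disjoint_sdiff_right]
  gcongr
  classical
  refine Finset.sum_le_sum_of_subset_of_nonneg (fun e he => ?_) fun e _ _ => hx e
  simp only [Finset.mem_filter, Finset.mem_univ, true_and, Set.mem_sdiff] at he ⊢
  exact he.1

end EdgeSum

/-! ### Splitting cycles and paths -/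

section CyclesAndPaths

variable {V : Type*} {G : SimpleGraph V}

/-- Removing an edge from a cycle leaves a path between the ends of that edge. -/
lemma exists_path_of_mem_cycle [DecidableEq V] {u : V} {c : G.Walk u u} (hc : c.IsCycle)
    {e : Sym2 V} (he : e ∈ c.edges) : ∃ (v w : V) (_ : G.Adj v w) (p : G.Walk v w), e = s(v, w) ∧
      p.IsPath ∧ e ∉ p.edges ∧ c.edgeSet = insert e p.edgeSet ∧
      ∀ a, a ∈ c.support ↔ a ∈ p.support := by
  obtain ⟨d, hd, rfl⟩ := List.mem_map.1 he
  have hmem : d.fst ∈ c.support := c.dart_fst_mem_support_of_mem_darts hd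
  have hc' := hc.rotate hmem
  have hd' : d ∈ (c.rotate _ hmem).darts := (c.rotate_darts _ hmem).mem_iff.2 hd
  have hes : ∀ e, e ∈ (c.rotate _ hmem).edges ↔ e ∈ c.edges :=
    fun e => (c.rotate_edges _ hmem).mem_iff
  have hsup : ∀ a, a ∈ (c.rotate _ hmem).support ↔ a ∈ c.support := by
    intro a
    simp
  generalize c.rotate _ hmem = c' at *
  obtain ⟨⟨a, b⟩, hab⟩ := d
  cases c' with
  | nil => simp at hd'
  | @cons _ y _ h p =>
    rw [SimpleGraph.Walk.cons_isCycle_iff] at hc'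
    simp only [SimpleGraph.Walk.darts_cons, List.mem_cons] at hd'
    have hby : y = b := by
      rcases hd' with hd' | hd'
      · exact (congrArg (fun d => d.snd) hd').symm
      · exfalso
        have h1 : a ∈ p.support.dropLast := by
          rw [← SimpleGraph.Walk.map_fst_darts]
          exact List.mem_map.2 ⟨_, hd', rfl⟩
        have h2 := List.dropLast_append_getLast p.support_ne_nil
        rw [SimpleGraph.Walk.getLast_support] at h2
        have h3 := hc'.1.support_nodup
        rw [← h2, List.nodup_append] at h3
        exact h3.2.2 a h1 a (List.mem_singleton_self a) rfl
    subst hby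
    refine ⟨a, y, hab, p.reverse, rfl, hc'.1.reverse, ?_, ?_, fun z => ?_⟩
    · simpa using hc'.2
    · ext e
      simp [← hes]
    · rw [← hsup]
      simp
      rintro rfl
      exact p.end_mem_support

/-- Two nodes of a walk split it into three parts. -/
lemma exists_append_of_mem_support [DecidableEq V] {v w : V} (p : G.Walk v w)
    {a b : V} (ha : a ∈ p.support) (hb : b ∈ p.support) :
    (∃ (q₁ : G.Walk v a) (q₂ : G.Walk a b) (q₃ : G.Walk b w), p = q₁.append (q₂.append q₃)) ∨
      ∃ (q₁ : G.Walk v b) (q₂ : G.Walk b a) (q₃ : G.Walk a w), p = q₁.append (q₂.append q₃) := by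
  have hspec := p.take_spec ha
  rw [← hspec, SimpleGraph.Walk.mem_support_append_iff] at hb
  rcases hb with hb | hb
  · refine .inr ⟨(p.takeUntil a ha).takeUntil b hb, (p.takeUntil a ha).dropUntil b hb,
      p.dropUntil a ha, ?_⟩
    rw [SimpleGraph.Walk.append_assoc, SimpleGraph.Walk.take_spec, hspec]
  · refine .inl ⟨p.takeUntil a ha, (p.dropUntil a ha).takeUntil b hb,
      (p.dropUntil a ha).dropUntil b hb, ?_⟩
    rw [SimpleGraph.Walk.take_spec, hspec]

end CyclesAndPaths

/-! ### The points of `X_{GG'}` -/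

section Points

variable {V : Type*} {G G' : SimpleGraph V}

open Classical in
/-- The characteristic vector of the set of edges of `G'` whose ends get different labels. For a
labeling with connected classes this is the lifted multicut of the decomposition into classes. -/
noncomputable def cutVector {α : Type*} (G' : SimpleGraph V) (ℓ : V → α) : G'.edgeSet → ℝ :=
  fun e => if ((e : Sym2 V).map ℓ).IsDiag then 0 else 1

variable {α : Type*} {ℓ : V → α}

lemma cutVector_apply [DecidableEq α] {a b : V} (h : G'.Adj a b) :
    cutVector G' ℓ ⟨s(a, b), h⟩ = if ℓ a = ℓ b then 0 else 1 := by
  simp [cutVector]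

lemma cutVector_zero_or_one (e : G'.edgeSet) : cutVector G' ℓ e = 0 ∨ cutVector G' ℓ e = 1 := by
  unfold cutVector
  split_ifs <;> simp

lemma cutVector_nonneg (e : G'.edgeSet) : 0 ≤ cutVector G' ℓ e := by
  rcases cutVector_zero_or_one (ℓ := ℓ) e with h | h <;> simp [h]

/-- A walk between nodes with different labels has an edge whose ends have different labels. -/
lemma exists_edge_label_ne {a b : V} (p : G.Walk a b) (h : ℓ a ≠ ℓ b) :
    ∃ c d, s(c, d) ∈ p.edges ∧ ℓ c ≠ ℓ d := by
  induction p with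
  | nil => exact absurd rfl h
  | @cons u x z hux p ih =>
    by_cases hx : ℓ u = ℓ x
    · obtain ⟨c, d, hcd, hne⟩ := ih (by rwa [← hx])
      exact ⟨c, d, by simp [hcd], hne⟩
    · exact ⟨u, x, by simp, hx⟩

lemma cutVector_le_edgeSum [Fintype V] (hle : G ≤ G') {a b : V} (p : G.Walk a b)
    (h : G'.Adj a b) : cutVector G' ℓ ⟨s(a, b), h⟩ ≤ edgeSum (cutVector G' ℓ) p.edgeSet := by
  classical
  rw [cutVector_apply]
  split_ifs with hl
  · exact edgeSum_nonneg cutVector_nonneg _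
  · obtain ⟨c, d, hcd, hne⟩ := exists_edge_label_ne p hl
    have hadj : G'.Adj c d := hle (p.adj_of_mem_edges hcd)
    have := le_edgeSum (x := cutVector G' ℓ) cutVector_nonneg (e := ⟨s(c, d), hadj⟩)
      (C := p.edgeSet) hcd
    rwa [cutVector_apply, if_neg hne] at this

/-- Lifted multicuts of decompositions of `G` into connected classes lie in `X_{GG'}`. -/
lemma cutVector_mem_X [Fintype V] (hle : G ≤ G')
    (hℓ : ∀ a b, ℓ a = ℓ b → ∃ p : G.Walk a b, ∀ c ∈ p.support, ℓ c = ℓ a) :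
    cutVector G' ℓ ∈ X G G' := by
  classical
  refine ⟨cutVector_zero_or_one, ?_, fun v w hf _ p _ => cutVector_le_edgeSum hle p hf, ?_⟩
  · intro u c hc e he
    obtain ⟨v, w, hvw, p, hevw, -, hep, hcp, -⟩ := exists_path_of_mem_cycle hc he
    rw [hcp, Set.insert_sdiff_self_of_notMem (show (e : Sym2 V) ∉ p.edgeSet from hep)]
    obtain rfl : e = ⟨s(v, w), hle hvw⟩ := Subtype.ext hevw
    exact cutVector_le_edgeSum hle p _
  · intro v w hf _ C hC
    have nonneg : ∀ e : G'.edgeSet, 0 ≤ 1 - cutVector G' ℓ e := fun e => by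
      rcases cutVector_zero_or_one (ℓ := ℓ) e with h | h <;> simp [h]
    rw [cutVector_apply]
    split_ifs with hl
    · obtain ⟨p, hp⟩ := hℓ v w hl
      obtain ⟨e, he, heC⟩ : ∃ e ∈ p.edges, e ∈ C := by
        by_contra! hno
        exact hC.prop.2 ⟨p.toDeleteEdges C hno⟩
      induction e with | _ c d =>
      have hadj := hle (p.adj_of_mem_edges he)
      have hcd : ℓ c = ℓ d := by
        rw [hp c (p.fst_mem_support_of_mem_edges he), hp d (p.snd_mem_support_of_mem_edges he)]
      have := le_edgeSum (x := fun e => 1 - cutVector G' ℓ e) nonneg (e := ⟨s(c, d), hadj⟩) heC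
      simpa [cutVector_apply, hcd] using this
    · have := edgeSum_nonneg nonneg C
      linarith

lemma zero_mem_X [Fintype V] (hG : G.Connected) (hle : G ≤ G') : (0 : G'.edgeSet → ℝ) ∈ X G G' := by
  have h : cutVector G' (fun _ : V => ()) = 0 := by
    ext e
    obtain ⟨e, he⟩ := e
    induction e with | _ a b =>
    simp [cutVector]
  rw [← h]
  exact cutVector_mem_X hle fun a b _ => (hG.preconnected a b).elim fun p => ⟨p, by simp⟩

/-- The edges of `G` at which the vector `x` vanishes. -/
def zeroGraph (G : SimpleGraph V) {G' : SimpleGraph V} (x : G'.edgeSet → ℝ) : SimpleGraph V where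
  Adj a b := G.Adj a b ∧ ∃ h : G'.Adj a b, x ⟨s(a, b), h⟩ = 0
  symm := ⟨by
    rintro a b ⟨h, h', hx⟩
    refine ⟨h.symm, h'.symm, ?_⟩
    rw [← hx]
    congr 2
    exact Sym2.eq_swap⟩
  loopless := ⟨fun a h => h.1.ne rfl⟩

lemma zeroGraph_le (x : G'.edgeSet → ℝ) : zeroGraph G x ≤ G := fun _ _ h => h.1

variable [Fintype V] {x : G'.edgeSet → ℝ}

lemma nonneg_of_mem_X (hx : x ∈ X G G') (e : G'.edgeSet) : 0 ≤ x e := by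
  rcases hx.1 e with h | h <;> simp [h]

/-- The cycle and the path inequalities together say the same about every edge of `G'`. -/
lemma le_edgeSum_path (hx : x ∈ X G G') {a b : V} (h : G'.Adj a b) (p : G.Walk a b)
    (hp : p.IsPath) (hab : s(a, b) ∉ p.edges) : x ⟨s(a, b), h⟩ ≤ edgeSum x p.edgeSet := by
  by_cases hadj : G.Adj a b
  · have hc : (SimpleGraph.Walk.cons hadj.symm p).IsCycle := by
      rw [SimpleGraph.Walk.cons_isCycle_iff]
      exact ⟨hp, by rwa [Sym2.eq_swap]⟩
    have := hx.2.1 b _ hc ⟨s(a, b), h⟩ (by simp [Sym2.eq_swap])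
    rwa [SimpleGraph.Walk.edgeSet_cons, Sym2.eq_swap (a := b) (b := a),
      Set.insert_sdiff_self_of_notMem (show s(a, b) ∉ p.edgeSet from hab)] at this
  · exact hx.2.2.1 a b h hadj p hp

/-- A point of `X_{GG'}` vanishes at an edge `ab` of `G'` exactly if `a` and `b` are joined by
edges of `G` at which it vanishes. For edges outside `G`, one direction is a cut inequality, for a
minimal cut among the edges with value `1`. -/
lemma eq_zero_iff_reachable (hx : x ∈ X G G') {a b : V} (h : G'.Adj a b) :
    x ⟨s(a, b), h⟩ = 0 ↔ (zeroGraph G x).Reachable a b := by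
  classical
  constructor
  · intro h0
    by_cases hadj : G.Adj a b
    · exact SimpleGraph.Adj.reachable (⟨hadj, h, h0⟩ : (zeroGraph G x).Adj a b)
    by_contra hnr
    let D : Set (Sym2 V) := G.edgeSet \ (zeroGraph G x).edgeSet
    have hD : D ⊆ G.edgeSet ∧ ¬ (G.deleteEdges D).Reachable a b := by
      refine ⟨Set.sdiff_subset, fun hr => hnr (hr.mono ?_)⟩
      intro c d hcd
      rw [SimpleGraph.deleteEdges_adj] at hcd
      by_contra hno
      exact hcd.2 ⟨hcd.1, hno⟩
    obtain ⟨C, hCD, hC⟩ := (Set.toFinite _).exists_le_minimal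
      (s := {D : Set (Sym2 V) | D ⊆ G.edgeSet ∧ ¬ (G.deleteEdges D).Reachable a b}) hD
    have hcut := hx.2.2.2 a b h hadj C hC
    rw [h0, edgeSum_eq_zero] at hcut
    · norm_num at hcut
    · rintro ⟨e, he⟩ heC
      induction e with | _ c d =>
      rcases hx.1 ⟨s(c, d), he⟩ with h1 | h1
      · exact absurd (show (zeroGraph G x).Adj c d from ⟨(hCD heC).1, he, h1⟩) (hCD heC).2
      · simp [h1]
  · rintro ⟨q⟩
    by_cases hab : s(a, b) ∈ q.bypass.edges
    · obtain ⟨-, _, h0⟩ := q.bypass.adj_of_mem_edges hab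
      exact h0
    refine le_antisymm ?_ (nonneg_of_mem_X hx _)
    have := le_edgeSum_path hx h (q.bypass.mapLe (zeroGraph_le x))
      ((SimpleGraph.Walk.isPath_mapLe _).2 q.bypass_isPath) (by simpa using hab)
    rwa [edgeSum_eq_zero] at this
    rintro ⟨e, he⟩ heq
    induction e with | _ c d =>
    rw [SimpleGraph.Walk.edgeSet_mapLe_eq_edgeSet] at heq
    obtain ⟨-, _, h0⟩ := q.bypass.adj_of_mem_edges heq
    exact h0

/-- Points of `X_{GG'}` satisfy the inequality of every walk of `G'` between the ends of an edge,
not only of the paths of `G`. -/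
lemma le_edgeSum_walk (hx : x ∈ X G G') {a b : V} (h : G'.Adj a b) (q : G'.Walk a b) :
    x ⟨s(a, b), h⟩ ≤ edgeSum x q.edgeSet := by
  by_cases hq : ∀ e : G'.edgeSet, (e : Sym2 V) ∈ q.edgeSet → x e = 0
  · rw [edgeSum_eq_zero hq]
    refine ((eq_zero_iff_reachable hx h).2 ?_).le
    clear h
    induction q with
    | nil => exact .refl _
    | @cons u y z huy q ih =>
      rw [SimpleGraph.Walk.edgeSet_cons] at hq
      exact ((eq_zero_iff_reachable hx huy).1 (hq ⟨_, huy⟩ (Set.mem_insert _ _))).trans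
        (ih fun e he => hq e (Set.mem_insert_of_mem _ he))
  · push Not at hq
    obtain ⟨e, he, hne⟩ := hq
    have h1 := le_edgeSum (nonneg_of_mem_X hx) he
    rw [(hx.1 e).resolve_left hne] at h1
    rcases hx.1 ⟨s(a, b), h⟩ with h2 | h2 <;> rw [h2] <;> linarith

end Points

/-! ### Facets in terms of linear functionals -/

section Convexity

lemma convexHull_inter_zero {E : Type*} [AddCommGroup E] [Module ℝ E] (l : E →ₗ[ℝ] ℝ) {A : Set E}
    (h : ∀ x ∈ A, l x ≤ 0) :
    convexHull ℝ {x ∈ A | l x = 0} = {x ∈ convexHull ℝ A | l x = 0} := by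
  refine subset_antisymm ?_ ?_
  · have hc : Convex ℝ {x ∈ convexHull ℝ A | l x = 0} :=
      (convex_convexHull ℝ A).inter (convex_hyperplane l.isLinear 0)
    exact convexHull_min (fun x hx => ⟨subset_convexHull ℝ A hx.1, hx.2⟩) hc
  · -- Being nonpositive, and in the hull of the zeros if zero, is a convex condition.
    have key : convexHull ℝ A ⊆ {x | l x ≤ 0 ∧ (l x = 0 → x ∈ convexHull ℝ {x ∈ A | l x = 0})} := by
      refine convexHull_min
        (fun x hx => ⟨h x hx, fun h0 => subset_convexHull ℝ _ ⟨hx, h0⟩⟩) ?_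
      intro x hx y hy a b ha hb hab
      have hax := mul_nonpos_of_nonneg_of_nonpos ha hx.1
      have hby := mul_nonpos_of_nonneg_of_nonpos hb hy.1
      simp only [Set.mem_ofPred_eq, map_add, map_smul, smul_eq_mul]
      refine ⟨by linarith, fun h0 => ?_⟩
      rcases ha.eq_or_lt with rfl | ha'
      · obtain rfl : b = 1 := by linarith
        simpa using hy.2 (by simpa using h0)
      rcases hb.eq_or_lt with rfl | hb'
      · obtain rfl : a = 1 := by linarith
        simpa using hx.2 (by simpa using h0)
      have h1 : l x = 0 := (mul_eq_zero.1 (by linarith : a * l x = 0)).resolve_left ha'.ne'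
      have h2 : l y = 0 := (mul_eq_zero.1 (by linarith : b * l y = 0)).resolve_left hb'.ne'
      exact convex_convexHull ℝ _ (hx.2 h1) (hy.2 h2) ha hb hab
    exact fun x hx => (key hx.1).2 hx.2

lemma vectorSpan_convexHull {E : Type*} [AddCommGroup E] [Module ℝ E] {S : Set E}
    (h : (0 : E) ∈ S) : vectorSpan ℝ (convexHull ℝ S) = Submodule.span ℝ S := by
  rw [← direction_affineSpan, affineSpan_convexHull, direction_affineSpan,
    vectorSpan_eq_span_vsub_set_right ℝ h]
  simp

lemma span_eq_top_of_forall_dual {E : Type*} [AddCommGroup E] [Module ℝ E] {S : Set E}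
    (h : ∀ φ : E →ₗ[ℝ] ℝ, (∀ x ∈ S, φ x = 0) → φ = 0) : Submodule.span ℝ S = ⊤ := by
  rw [← Submodule.dualAnnihilator_eq_bot_iff, Submodule.eq_bot_iff]
  intro φ hφ
  exact h φ fun x hx => (Submodule.mem_dualAnnihilator φ).1 hφ x (Submodule.subset_span hx)

/-- Given a full-dimensional polytope with vertices in `A ∋ 0` and a valid inequality `l ≤ 0`, the
points of `A` with `l = 0` span a facet if and only if every linear functional vanishing at these
points is a multiple of `l`. -/
lemma isFacet_iff_forall_dual {ι : Type*} [Finite ι] {A : Set (ι → ℝ)} (h0 : 0 ∈ A)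
    (hA : Submodule.span ℝ A = ⊤) {l : (ι → ℝ) →ₗ[ℝ] ℝ} (hl : l ≠ 0) (h : ∀ x ∈ A, l x ≤ 0) :
    IsFacet (convexHull ℝ A) (convexHull ℝ {x ∈ A | l x = 0}) ↔
      ∀ φ : (ι → ℝ) →ₗ[ℝ] ℝ, (∀ x ∈ A, l x = 0 → φ x = 0) → ∃ c : ℝ, φ = c • l := by
  classical
  have := Fintype.ofFinite ι
  have h0' : (0 : ι → ℝ) ∈ {x ∈ A | l x = 0} := ⟨h0, map_zero l⟩
  have hexp : IsExposed ℝ (convexHull ℝ A) (convexHull ℝ {x ∈ A | l x = 0}) := by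
    refine fun _ => ⟨LinearMap.toContinuousLinearMap l, ?_⟩
    have hneg : ∀ x ∈ convexHull ℝ A, l x ≤ 0 :=
      fun x hx => convexHull_min h (convex_halfSpace_le l.isLinear 0) hx
    rw [convexHull_inter_zero l h]
    ext x
    simp only [Set.mem_ofPred_eq, LinearMap.coe_toContinuousLinearMap']
    refine and_congr_right fun hx => ⟨fun hx0 y hy => hx0 ▸ hneg y hy, fun hmax => ?_⟩
    exact le_antisymm (hneg x hx) (by simpa using hmax 0 (subset_convexHull ℝ A h0))
  set W := Submodule.span ℝ {x ∈ A | l x = 0} with hW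
  have mem : ∀ φ : Module.Dual ℝ (ι → ℝ),
      φ ∈ W.dualAnnihilator ↔ ∀ x ∈ A, l x = 0 → φ x = 0 := by
    intro φ
    rw [hW, Submodule.mem_dualAnnihilator]
    refine ⟨fun hφ x hx hx0 => hφ x (Submodule.subset_span ⟨hx, hx0⟩), fun hφ x hx => ?_⟩
    have : W ≤ LinearMap.ker φ := Submodule.span_le.2 fun y hy => hφ y hy.1 hy.2
    exact this hx
  have hlW : l ∈ W.dualAnnihilator := (mem l).2 fun x _ hx => hx
  have hdim := Subspace.finrank_add_finrank_dualAnnihilator_eq W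
  unfold IsFacet
  rw [vectorSpan_convexHull h0', vectorSpan_convexHull h0, hA, finrank_top, ← hW]
  have hone : Module.finrank ℝ W + 1 = Module.finrank ℝ (ι → ℝ) ↔
      Module.finrank ℝ W.dualAnnihilator = 1 := by omega
  rw [hone, finrank_eq_one_iff_of_nonzero' (⟨l, hlW⟩ : W.dualAnnihilator)
    (fun hh => hl (congrArg Subtype.val hh))]
  constructor
  · rintro ⟨-, -, hmul⟩ φ hφ
    obtain ⟨c, hc⟩ := hmul ⟨φ, (mem φ).2 hφ⟩
    exact ⟨c, (congrArg Subtype.val hc).symm⟩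
  · intro hmul
    refine ⟨⟨0, subset_convexHull ℝ _ h0'⟩, hexp, fun φ => ?_⟩
    obtain ⟨c, hc⟩ := hmul φ ((mem φ).1 φ.2)
    exact ⟨c, Subtype.ext hc.symm⟩

end Convexity

/-! ### Coefficients of a linear functional -/

section Functionals

variable {V : Type*} {G G' : SimpleGraph V}

open Classical in
/-- The coefficient of a linear functional on `ℝ^{E'}` at the pair `xy`, zero for pairs that are not
edges of `G'`. -/
noncomputable def weight (φ : (G'.edgeSet → ℝ) →ₗ[ℝ] ℝ) (x y : V) : ℝ :=
  if h : G'.Adj x y then φ (Pi.single ⟨s(x, y), h⟩ 1) else 0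

variable {φ : (G'.edgeSet → ℝ) →ₗ[ℝ] ℝ}

lemma weight_of_adj [DecidableEq G'.edgeSet] {x y : V} (h : G'.Adj x y) :
    weight φ x y = φ (Pi.single ⟨s(x, y), h⟩ 1) := by
  rw [weight, dif_pos h]
  congr!

lemma weight_of_not_adj {x y : V} (h : ¬ G'.Adj x y) : weight φ x y = 0 :=
  dif_neg h

lemma weight_comm (x y : V) : weight φ x y = weight φ y x := by
  classical
  by_cases h : G'.Adj x y
  · rw [weight_of_adj h, weight_of_adj h.symm]
    congr 3
    exact Sym2.eq_swap
  · rw [weight_of_not_adj h, weight_of_not_adj fun h' => h h'.symm]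

lemma weight_self (x : V) : weight φ x x = 0 :=
  weight_of_not_adj (G'.loopless.irrefl x)

variable [Fintype V]

/-- The double sum counts every edge twice, once for each order of its ends. -/
lemma sum_weight_mul (F : V → V → ℝ) (z : G'.edgeSet → ℝ)
    (hF : ∀ x y (h : G'.Adj x y), F x y = z ⟨s(x, y), h⟩) :
    ∑ x, ∑ y, weight φ x y * F x y = 2 * φ z := by
  classical
  have hterm : ∀ x y, weight φ x y * F x y =
      ∑ e : G'.edgeSet, if (e : Sym2 V) = s(x, y) then z e * φ (Pi.single e 1) else 0 := by
    intro x y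
    by_cases h : G'.Adj x y
    · rw [weight_of_adj h, hF x y h, Finset.sum_eq_single_of_mem ⟨s(x, y), h⟩ (Finset.mem_univ _),
        if_pos rfl, mul_comm]
      intro e _ he
      exact if_neg fun he' => he (Subtype.ext he')
    · rw [weight_of_not_adj h, zero_mul, Finset.sum_eq_zero]
      rintro ⟨e, he⟩ -
      refine if_neg ?_
      rintro rfl
      exact h he
  have hφ : φ z = ∑ e, z e * φ (Pi.single e 1) := by
    conv_lhs => rw [pi_eq_sum_univ' z, map_sum]
    refine Finset.sum_congr rfl fun e _ => ?_
    rw [map_smul, smul_eq_mul]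
  simp only [hterm]
  rw [← Fintype.sum_prod_type', Finset.sum_comm, hφ, Finset.mul_sum]
  refine Finset.sum_congr rfl ?_
  rintro ⟨e, he⟩ -
  induction e with | _ a b =>
  have hab : a ≠ b := G'.ne_of_adj he
  rw [Finset.sum_eq_add_of_mem (a, b) (b, a) (by simp) (by simp) (by simp [hab])]
  · rw [if_pos rfl, if_pos Sym2.eq_swap]
    ring
  · rintro ⟨x, y⟩ - hne
    refine if_neg fun h => ?_
    rcases Sym2.eq_iff.1 h with ⟨rfl, rfl⟩ | ⟨rfl, rfl⟩
    exacts [hne.1 rfl, hne.2 rfl]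

end Functionals

/-! ### Multicuts with two blocks and the dimension of the polytope -/

section Blocks

variable {V : Type*} [DecidableEq V] {G G' : SimpleGraph V} {B₁ B₂ : Finset V}

/-- The labeling with classes `B₁`, `B₂` and singletons. -/
def blockLabel (B₁ B₂ : Finset V) (x : V) : V ⊕ Bool :=
  if x ∈ B₁ then .inr true else if x ∈ B₂ then .inr false else .inl x

lemma blockLabel_eq_iff (hd : Disjoint B₁ B₂) {x y : V} :
    blockLabel B₁ B₂ x = blockLabel B₁ B₂ y ↔
      x = y ∨ (x ∈ B₁ ∧ y ∈ B₁) ∨ (x ∈ B₂ ∧ y ∈ B₂) := by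
  have := Finset.disjoint_left.1 hd
  unfold blockLabel
  grind

lemma cutVector_blockLabel_mem_X [Fintype V] (hle : G ≤ G') (h₁ : ConnOn G B₁) (h₂ : ConnOn G B₂)
    (hd : Disjoint B₁ B₂) : cutVector G' (blockLabel B₁ B₂) ∈ X G G' := by
  refine cutVector_mem_X hle fun a b hab => ?_
  rcases (blockLabel_eq_iff hd).1 hab with rfl | ⟨ha, hb⟩ | ⟨ha, hb⟩
  · exact ⟨.nil, by simp⟩
  · obtain ⟨p, hp⟩ := h₁ a ha b hb
    exact ⟨p, fun c hc => (blockLabel_eq_iff hd).2 (.inr (.inl ⟨hp c hc, ha⟩))⟩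
  · obtain ⟨p, hp⟩ := h₂ a ha b hb
    exact ⟨p, fun c hc => (blockLabel_eq_iff hd).2 (.inr (.inr ⟨hp c hc, ha⟩))⟩

/-- Twice the value of a functional at the multicut with blocks `B₁` and `B₂` and singletons is its
total weight on ordered pairs minus the weight inside the two blocks. -/
lemma two_mul_apply_cutVector [Fintype V] (φ : (G'.edgeSet → ℝ) →ₗ[ℝ] ℝ) (hd : Disjoint B₁ B₂) :
    2 * φ (cutVector G' (blockLabel B₁ B₂)) = cross (weight φ) Finset.univ Finset.univ -
      (cross (weight φ) B₁ B₁ + cross (weight φ) B₂ B₂) := by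
  rw [← sum_weight_mul (fun x y => if blockLabel B₁ B₂ x = blockLabel B₁ B₂ y then 0 else 1) _
    fun x y h => (cutVector_apply h).symm]
  have hcross : ∀ B : Finset V, cross (weight φ) B B =
      ∑ x, ∑ y, if x ∈ B ∧ y ∈ B then weight φ x y else 0 := by
    intro B
    simp [cross, ite_and, Finset.sum_ite_mem]
  rw [hcross B₁, hcross B₂, cross, ← Finset.sum_add_distrib, ← Finset.sum_sub_distrib]
  refine Finset.sum_congr rfl fun x _ => ?_
  rw [← Finset.sum_add_distrib, ← Finset.sum_sub_distrib]
  refine Finset.sum_congr rfl fun y _ => ?_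
  have hdis := Finset.disjoint_left.1 hd
  have h0 := weight_self (φ := φ) x
  simp only [blockLabel_eq_iff hd]
  by_cases hxy : x = y
  · subst hxy
    simp [h0]
  · by_cases h1 : x ∈ B₁ ∧ y ∈ B₁
    · have h2 : ¬ (x ∈ B₂ ∧ y ∈ B₂) := fun h => hdis h1.1 h.1
      simp [h1, h2]
    · by_cases h2 : x ∈ B₂ ∧ y ∈ B₂ <;> simp [hxy, h1, h2]

/-- The lifted multicut polytope of a connected graph is full-dimensional. -/
lemma span_X [Fintype V] (hG : G.Connected) (hle : G ≤ G') :
    Submodule.span ℝ (X G G') = ⊤ := by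
  refine span_eq_top_of_forall_dual fun φ hφ => ?_
  have htot : ∀ B : Finset V, ConnOn G B → cross (weight φ) B B =
      cross (weight φ) Finset.univ Finset.univ := by
    intro B hB
    have := two_mul_apply_cutVector φ (Finset.disjoint_empty_right B)
    rw [hφ _ (cutVector_blockLabel_mem_X hle hB .empty (Finset.disjoint_empty_right B))] at this
    simp only [cross, Finset.sum_empty] at this ⊢
    linarith
  have hzero := htot ∅ .empty
  refine LinearMap.pi_ext' fun ⟨e, he⟩ => LinearMap.ext_ring ?_
  induction e with | _ a b =>
  obtain ⟨p⟩ := hG.preconnected a b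
  have := weight_eq_zero_of_walk (β := weight φ) (Q := ∅) weight_comm weight_self
    (fun B hB _ => by rw [htot B hB, ← hzero]; simp [cross]) p (by simp)
  rw [weight_of_adj he] at this
  simpa using this

end Blocks

/-! ### The facets -/

section Facets

variable {V : Type*} [Fintype V] {G G' : SimpleGraph V} {v w a b : V}

/-- The linear form `x_f - ∑_{e ∈ C} x_e`. -/
noncomputable def pathForm (f : G'.edgeSet) (C : Set (Sym2 V)) : (G'.edgeSet → ℝ) →ₗ[ℝ] ℝ where
  toFun x := x f - edgeSum x C
  map_add' x y := by
    simp only [edgeSum, Pi.add_apply, Finset.sum_add_distrib]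
    ring
  map_smul' c x := by
    simp only [edgeSum, Pi.smul_apply, smul_eq_mul, ← Finset.mul_sum, RingHom.id_apply]
    ring

@[simp]
lemma pathForm_apply (f : G'.edgeSet) (C : Set (Sym2 V)) (x : G'.edgeSet → ℝ) :
    pathForm f C x = x f - edgeSum x C :=
  rfl

lemma edgeSum_single_of_mem [DecidableEq G'.edgeSet] {C : Set (Sym2 V)} {e : G'.edgeSet}
    (h : (e : Sym2 V) ∈ C) : edgeSum (Pi.single e 1) C = 1 := by
  rw [edgeSum_eq_single h fun e' _ he' => Pi.single_eq_of_ne he' 1, Pi.single_eq_same]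

lemma edgeSum_single_of_notMem [DecidableEq G'.edgeSet] {C : Set (Sym2 V)} {e : G'.edgeSet}
    (h : (e : Sym2 V) ∉ C) : edgeSum (Pi.single e 1) C = 0 :=
  edgeSum_eq_zero fun e' he' => Pi.single_eq_of_ne (by rintro rfl; exact h he') 1

/-- A chord `ab` of the cycle formed by `f = vw` and the path `p` gives a second equation on the
face: the value at the chord is the sum over the part of the path between `a` and `b`. -/
lemma eq_edgeSum_of_chord (hle : G ≤ G') (hf : G'.Adj v w) {q₁ : G.Walk v a} {q₂ : G.Walk a b}
    {q₃ : G.Walk b w} (hp : (q₁.append (q₂.append q₃)).IsPath) (hab : G'.Adj a b)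
    {x : G'.edgeSet → ℝ} (hx : x ∈ X G G')
    (heq : x ⟨s(v, w), hf⟩ = edgeSum x (q₁.append (q₂.append q₃)).edgeSet) :
    x ⟨s(a, b), hab⟩ = edgeSum x q₂.edgeSet := by
  have hnd := hp.isTrail.edges_nodup
  rw [SimpleGraph.Walk.edges_append, SimpleGraph.Walk.edges_append, List.nodup_append] at hnd
  obtain ⟨-, h23, h1⟩ := hnd
  obtain ⟨-, -, h2⟩ := List.nodup_append.1 h23
  have d23 : Disjoint q₂.edgeSet q₃.edgeSet :=
    Set.disjoint_left.2 fun e he he' => h2 e he e he' rfl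
  have d1 : Disjoint q₁.edgeSet (q₂.edgeSet ∪ q₃.edgeSet) :=
    Set.disjoint_left.2 fun e he he' => h1 e he e (by simpa using he') rfl
  rw [SimpleGraph.Walk.edgeSet_append, SimpleGraph.Walk.edgeSet_append, edgeSum_union d1,
    edgeSum_union d23] at heq
  refine le_antisymm ?_ ?_
  · simpa using le_edgeSum_walk hx hab (q₂.mapLe hle)
  · have hnn := nonneg_of_mem_X hx
    have hshort := le_edgeSum_walk hx hf
      ((q₁.mapLe hle).append (.cons hab (q₃.mapLe hle)))
    have hu1 := edgeSum_union_le hnn q₁.edgeSet ({s(a, b)} ∪ q₃.edgeSet)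
    have hu2 := edgeSum_union_le hnn {s(a, b)} q₃.edgeSet
    have hs : edgeSum x {s(a, b)} = x ⟨s(a, b), hab⟩ :=
      edgeSum_eq_single rfl fun e he hne => absurd (Subtype.ext (Set.mem_singleton_iff.1 he)) hne
    rw [SimpleGraph.Walk.edgeSet_append, SimpleGraph.Walk.edgeSet_cons,
      SimpleGraph.Walk.edgeSet_mapLe_eq_edgeSet, SimpleGraph.Walk.edgeSet_mapLe_eq_edgeSet,
      Set.insert_eq] at hshort
    linarith

/-- The face is contained in a second hyperplane if the cycle has a chord. -/
lemma false_of_chord (hle : G ≤ G') (hf : G'.Adj v w) {p : G.Walk v w} (hp : p.IsPath)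
    (hdual : ∀ φ : (G'.edgeSet → ℝ) →ₗ[ℝ] ℝ,
      (∀ x ∈ X G G', pathForm ⟨s(v, w), hf⟩ p.edgeSet x = 0 → φ x = 0) →
        ∃ c : ℝ, φ = c • pathForm ⟨s(v, w), hf⟩ p.edgeSet)
    {a b : V} {q₁ : G.Walk v a} {q₂ : G.Walk a b} {q₃ : G.Walk b w}
    (hq : p = q₁.append (q₂.append q₃)) (hab : G'.Adj a b) (h1 : s(a, b) ∉ p.edges)
    (h2 : s(a, b) ≠ s(v, w)) : False := by
  classical
  obtain ⟨c, hc⟩ := hdual (pathForm ⟨s(a, b), hab⟩ q₂.edgeSet) (by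
    intro x hx hx0
    rw [pathForm_apply, sub_eq_zero] at hx0 ⊢
    subst hq
    exact eq_edgeSum_of_chord hle hf hp hab hx hx0)
  have h3 : s(a, b) ∉ q₂.edgeSet := fun h => h1 (by
    rw [hq, SimpleGraph.Walk.edges_append, SimpleGraph.Walk.edges_append]
    exact List.mem_append_right _ (List.mem_append_left _ h))
  have := LinearMap.congr_fun hc (Pi.single ⟨s(a, b), hab⟩ 1)
  rw [LinearMap.smul_apply, pathForm_apply, pathForm_apply, edgeSum_single_of_notMem h3,
    edgeSum_single_of_notMem (C := p.edgeSet) (e := ⟨s(a, b), hab⟩) h1, Pi.single_eq_same,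
    Pi.single_eq_of_ne fun h => h2 (congrArg Subtype.val h).symm] at this
  norm_num at this

/-- The coefficients of a functional vanishing on the face satisfy the weight identities: the
multicuts with two blocks considered there lie on the face. -/
lemma balanced_weight [DecidableEq V] (hle : G ≤ G') (hf : G'.Adj v w) {p : G.Walk v w}
    {φ : (G'.edgeSet → ℝ) →ₗ[ℝ] ℝ}
    (hφ : ∀ x ∈ X G G', pathForm ⟨s(v, w), hf⟩ p.edgeSet x = 0 → φ x = 0) :
    Balanced p (weight φ) (cross (weight φ) Finset.univ Finset.univ) := by
  have key : ∀ B₁ B₂ : Finset V, ConnOn G B₁ → ConnOn G B₂ → Disjoint B₁ B₂ →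
      cutVector G' (blockLabel B₁ B₂) ⟨s(v, w), hf⟩ =
        edgeSum (cutVector G' (blockLabel B₁ B₂)) p.edgeSet →
      cross (weight φ) B₁ B₁ + cross (weight φ) B₂ B₂ =
        cross (weight φ) Finset.univ Finset.univ := by
    intro B₁ B₂ h₁ h₂ hd heq
    have := two_mul_apply_cutVector φ hd
    rw [hφ _ (cutVector_blockLabel_mem_X hle h₁ h₂ hd)
      (by rw [pathForm_apply, sub_eq_zero, heq])] at this
    linarith
  refine ⟨weight_comm, weight_self, fun B₁ B₂ h₁ h₂ hd hsub => key B₁ B₂ h₁ h₂ hd ?_,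
    fun B₁ B₂ h₁ h₂ hd i hi hsub₁ hsub₂ => key B₁ B₂ h₁ h₂ hd ?_⟩
  · have hmem : ∀ a ∈ p.support, a ∈ B₁ := fun a ha => hsub (mem_segment_length.2 ha)
    rw [edgeSum_eq_zero, cutVector_apply, if_pos]
    · exact (blockLabel_eq_iff hd).2
        (.inr (.inl ⟨hmem _ p.start_mem_support, hmem _ p.end_mem_support⟩))
    · rintro ⟨e, he⟩ hep
      induction e with | _ a b =>
      rw [cutVector_apply he, if_pos]
      exact (blockLabel_eq_iff hd).2 (.inr (.inl ⟨hmem _ (p.fst_mem_support_of_mem_edges hep),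
        hmem _ (p.snd_mem_support_of_mem_edges hep)⟩))
  · -- The only edge of the path between different blocks joins the positions `i` and `i + 1`.
    have m1 : ∀ s, s ≤ i → p.getVert s ∈ B₁ :=
      fun s hs => hsub₁ (mem_segment.2 ⟨s, Nat.zero_le s, hs, rfl⟩)
    have m2 : ∀ s, i < s → s ≤ p.length → p.getVert s ∈ B₂ :=
      fun s hs hs' => hsub₂ (mem_segment.2 ⟨s, hs, hs', rfl⟩)
    have cut : ∀ s t, s ≤ i → i < t → t ≤ p.length → blockLabel B₁ B₂ (p.getVert s) ≠
        blockLabel B₁ B₂ (p.getVert t) := by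
      intro s t hs ht ht' heq
      have hdis := Finset.disjoint_left.1 hd
      rcases (blockLabel_eq_iff hd).1 heq with h | h | h
      · exact hdis (m1 s hs) (h ▸ m2 t ht ht')
      · exact hdis h.2 (m2 t ht ht')
      · exact hdis (m1 s hs) h.1
    have hadj := hle (p.adj_getVert_succ hi)
    have hvw := cut 0 p.length (Nat.zero_le i) hi le_rfl
    rw [p.getVert_zero, p.getVert_length] at hvw
    rw [edgeSum_eq_single (e := ⟨s(p.getVert i, p.getVert (i + 1)), hadj⟩), cutVector_apply,
      cutVector_apply, if_neg hvw, if_neg (cut i (i + 1) le_rfl (by omega) hi)]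
    · exact (p.mk_mem_edges_iff_exists).2 ⟨i, hi, rfl⟩
    · rintro ⟨e, he⟩ hep hne
      induction e with | _ a b =>
      obtain ⟨j, hj, hje⟩ := (p.mk_mem_edges_iff_exists).1 hep
      have hji : j ≠ i := by
        rintro rfl
        exact hne (Subtype.ext hje.symm)
      have hadj' := hle (p.adj_getVert_succ hj)
      rw [show (⟨s(a, b), he⟩ : G'.edgeSet) = ⟨s(p.getVert j, p.getVert (j + 1)), hadj'⟩ from
        Subtype.ext hje.symm, cutVector_apply, if_pos]
      refine (blockLabel_eq_iff hd).2 (.inr ?_)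
      rcases lt_or_gt_of_ne hji with h | h
      · exact .inl ⟨m1 j h.le, m1 (j + 1) h⟩
      · exact .inr ⟨m2 j h hj.le, m2 (j + 1) (by omega) hj⟩

/-- If the cycle is chordless, then every linear functional vanishing on the face is a multiple of
the form that defines the face. -/
lemma eq_smul_pathForm (hG : G.Connected) (hle : G ≤ G') (hf : G'.Adj v w) {p : G.Walk v w}
    (hp : p.IsPath) (hne : s(v, w) ∉ p.edges)
    (hch : ∀ a ∈ p.support, ∀ b ∈ p.support, G'.Adj a b → s(a, b) ∈ p.edges ∨ s(a, b) = s(v, w))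
    {φ : (G'.edgeSet → ℝ) →ₗ[ℝ] ℝ}
    (hφ : ∀ x ∈ X G G', pathForm ⟨s(v, w), hf⟩ p.edgeSet x = 0 → φ x = 0) :
    φ = weight φ v w • pathForm ⟨s(v, w), hf⟩ p.edgeSet := by
  classical
  have hbal := balanced_weight hle hf hφ
  have inj : ∀ s t, s ≤ p.length → t ≤ p.length → p.getVert s = p.getVert t → s = t :=
    fun s t hs ht => hp.getVert_injOn hs ht
  have hlen : 2 ≤ p.length := by
    by_contra hlt
    have hl : p.length ≠ 0 := fun h0 => hf.ne (SimpleGraph.Walk.eq_of_length_eq_zero h0)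
    have hl1 : p.length = 1 := by omega
    refine hne (p.mk_mem_edges_iff_exists.2 ⟨0, by omega, ?_⟩)
    rw [p.getVert_zero, zero_add, ← hl1, p.getVert_length]
  have hedge : ∀ i < p.length, weight φ (p.getVert i) (p.getVert (i + 1)) = - weight φ v w := by
    intro i hi
    refine eq_neg_of_add_eq_zero_left (hbal.add_eq_zero hp hlen ?_ hi)
    intro s t hst ht hts hends
    refine weight_of_not_adj fun hadj => ?_
    rcases hch _ (p.getVert_mem_support s) _ (p.getVert_mem_support t) hadj with h | h
    · obtain ⟨j, hj, hje⟩ := p.mk_mem_edges_iff_exists.1 h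
      rcases Sym2.eq_iff.1 hje with ⟨h1, h2⟩ | ⟨h1, h2⟩
      · have := inj _ _ hj.le (by omega) h1
        have := inj _ _ hj ht h2
        omega
      · have := inj _ _ hj.le ht h1
        have := inj _ _ hj (by omega) h2
        omega
    · rcases Sym2.eq_iff.1 h with ⟨h1, h2⟩ | ⟨h1, -⟩
      · exact hends ⟨inj s 0 (by omega) (by omega) (h1.trans p.getVert_zero.symm),
          inj t _ ht le_rfl (h2.trans p.getVert_length.symm)⟩
      · have := inj s _ (by omega) le_rfl (h1.trans p.getVert_length.symm)
        omega
  refine LinearMap.pi_ext' fun ⟨e, he⟩ => LinearMap.ext_ring ?_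
  induction e with | _ a b =>
  have hw : weight φ a b = weight φ v w * pathForm ⟨s(v, w), hf⟩ p.edgeSet
      (Pi.single ⟨s(a, b), he⟩ 1) := by
    rw [pathForm_apply]
    by_cases h1 : s(a, b) = s(v, w)
    · have h2 : s(a, b) ∉ p.edgeSet := by rwa [h1]
      have h3 : (⟨s(v, w), hf⟩ : G'.edgeSet) = ⟨s(a, b), he⟩ := Subtype.ext h1.symm
      rw [edgeSum_single_of_notMem (C := p.edgeSet) (e := ⟨s(a, b), he⟩) h2, h3,
        Pi.single_eq_same, sub_zero, mul_one]
      rcases Sym2.eq_iff.1 h1 with ⟨rfl, rfl⟩ | ⟨rfl, rfl⟩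
      exacts [rfl, weight_comm _ _]
    rw [Pi.single_eq_of_ne fun h => h1 (congrArg Subtype.val h).symm]
    by_cases h2 : s(a, b) ∈ p.edges
    · rw [edgeSum_single_of_mem (C := p.edgeSet) (e := ⟨s(a, b), he⟩) h2]
      obtain ⟨i, hi, hie⟩ := p.mk_mem_edges_iff_exists.1 h2
      have := hedge i hi
      rcases Sym2.eq_iff.1 hie with ⟨rfl, rfl⟩ | ⟨rfl, rfl⟩
      · linarith
      · rw [weight_comm]
        linarith
    rw [edgeSum_single_of_notMem (C := p.edgeSet) (e := ⟨s(a, b), he⟩) h2, sub_zero, mul_zero]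
    by_cases ha : a ∈ segment p 0 p.length
    · by_cases hb : b ∈ segment p 0 p.length
      · rcases hch a (mem_segment_length.1 ha) b (mem_segment_length.1 hb) he with h | h
        exacts [absurd h h2, absurd h h1]
      · rw [weight_comm]
        exact hbal.eq_zero_of_mem_right hG hp b hb a ha
    · by_cases hb : b ∈ segment p 0 p.length
      · exact hbal.eq_zero_of_mem_right hG hp a ha b hb
      · exact hbal.eq_zero_of_notMem hG hp ha hb
  rw [weight_of_adj he] at hw
  simpa using hw

/-- Both parts of the theorem in one: for an edge `f = vw` of `G'` and a path `p` of `G` between its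
ends that avoids `f`, the inequality `x_f ≤ ∑_{e ∈ p} x_e` defines a facet if and only if the cycle
formed by `f` and `p` is chordless in `G'`. -/
lemma isFacet_sigmaPath_iff (hG : G.Connected) (hle : G ≤ G') (hf : G'.Adj v w) {p : G.Walk v w}
    (hp : p.IsPath) (hne : s(v, w) ∉ p.edges) :
    IsFacet (Xi G G') (SigmaPath G G' ⟨s(v, w), hf⟩ p.edgeSet) ↔
      ∀ a ∈ p.support, ∀ b ∈ p.support, G'.Adj a b →
        s(a, b) ∈ p.edges ∨ s(a, b) = s(v, w) := by
  classical
  have hform : pathForm ⟨s(v, w), hf⟩ p.edgeSet ≠ 0 := by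
    intro h0
    have := LinearMap.congr_fun h0 (Pi.single ⟨s(v, w), hf⟩ 1)
    rw [pathForm_apply, edgeSum_single_of_notMem (C := p.edgeSet) (e := ⟨s(v, w), hf⟩) hne,
      Pi.single_eq_same] at this
    norm_num at this
  have hdual := isFacet_iff_forall_dual (zero_mem_X hG hle) (span_X hG hle) hform fun x hx =>
    sub_nonpos.2 (le_edgeSum_path hx hf p hp hne)
  have hsigma : SigmaPath G G' ⟨s(v, w), hf⟩ p.edgeSet =
      convexHull ℝ {x ∈ X G G' | pathForm ⟨s(v, w), hf⟩ p.edgeSet x = 0} := by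
    simp only [SigmaPath, pathForm_apply, sub_eq_zero]
  rw [hsigma, Xi, hdual]
  constructor
  · intro h a ha b hb hab
    by_contra! hno
    rcases exists_append_of_mem_support p ha hb with ⟨q₁, q₂, q₃, hq⟩ | ⟨q₁, q₂, q₃, hq⟩
    · exact false_of_chord hle hf hp h hq hab hno.1 hno.2
    · rw [Sym2.eq_swap] at hno
      exact false_of_chord hle hf hp h hq hab.symm hno.1 hno.2
  · exact fun hch φ hφ => ⟨_, eq_smul_pathForm hG hle hf hp hne hch hφ⟩

end Facets

end LiftedMulticut

theorem theorem4 {V : Type*} [Fintype V] (G G' : SimpleGraph V) (hG : G.Connected) (hle : G ≤ G') :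
    (∀ (u : V) (c : G.Walk u u), c.IsCycle → ∀ e : G'.edgeSet, (e : Sym2 V) ∈ c.edges →
      (LiftedMulticut.IsFacet (LiftedMulticut.Xi G G')
          (LiftedMulticut.SigmaCycle G G' e c.edgeSet) ↔
        (c.mapLe hle).IsChordless)) ∧
    (∀ (v w : V) (hf : G'.Adj v w), ¬ G.Adj v w → ∀ p : G.Walk v w, p.IsPath →
      (LiftedMulticut.IsFacet (LiftedMulticut.Xi G G')
          (LiftedMulticut.SigmaPath G G' ⟨s(v, w), hf⟩ p.edgeSet) ↔
        (SimpleGraph.Walk.cons hf.symm (p.mapLe hle)).IsChordless)) := by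
  classical
  constructor
  · intro u c hc e he
    obtain ⟨v, w, hvw, p, hevw, hp, hep, hcp, hsup⟩ := LiftedMulticut.exists_path_of_mem_cycle hc he
    have hedges : ∀ z, z ∈ c.edges ↔ z = e ∨ z ∈ p.edges := fun z => Set.ext_iff.1 hcp z
    obtain rfl : e = ⟨s(v, w), hle hvw⟩ := Subtype.ext hevw
    have hsigma : LiftedMulticut.SigmaCycle G G' ⟨s(v, w), hle hvw⟩ c.edgeSet =
        LiftedMulticut.SigmaPath G G' ⟨s(v, w), hle hvw⟩ p.edgeSet := by
      rw [LiftedMulticut.SigmaCycle, LiftedMulticut.SigmaPath, hcp,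
        Set.insert_sdiff_self_of_notMem (show s(v, w) ∉ p.edgeSet from hep)]
    rw [hsigma, LiftedMulticut.isFacet_sigmaPath_iff hG hle (hle hvw) hp hep,
      SimpleGraph.Walk.isChordless_iff_forall_mem_edges]
    simp only [SimpleGraph.Walk.support_mapLe_eq_support, SimpleGraph.Walk.edges_mapLe_eq_edges,
      hsup, hedges]
    grind
  · intro v w hf hvw p hp
    have hne : s(v, w) ∉ p.edges := fun h => hvw (p.adj_of_mem_edges h)
    rw [LiftedMulticut.isFacet_sigmaPath_iff hG hle hf hp hne,
      SimpleGraph.Walk.isChordless_iff_forall_mem_edges]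
    have hw : ∀ a, a ∈ (SimpleGraph.Walk.cons hf.symm (p.mapLe hle)).support ↔ a ∈ p.support := by
      intro a
      simp
      rintro rfl
      exact p.end_mem_support
    simp only [hw, SimpleGraph.Walk.edges_cons, List.mem_cons,
      SimpleGraph.Walk.edges_mapLe_eq_edges, Sym2.eq_swap (a := w) (b := v)]
    grind
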